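/- Let $\mathbb K\in\{\mathbb R,\mathbb C\}$ and $n\in\mathbb N$. A full tensor norm $\alpha$ of order $n$ assigns to every $n$-tuple $(E_1,\dots,E_n)$ of Banach spaces over $\mathbb K$ a norm $\alpha(\,\cdot\,;\otimes_{i=1}^nE_i)$ on the algebraic tensor product $\otimes_{i=1}^n E_i$ such that $\varepsilon\le\alpha\le\pi$ (the injective and projective norms) and $\|\otimes_i T_i:(\otimes_iE_i,\alpha)\to(\otimes_iF_i,\alpha)\|\le\prod_i\|T_i\|$ for all bounded linear operators $T_i:E_i\to F_i$. It is finitely generated if $\alpha(z;\otimes_iE_i)=\inf\alpha(z;\otimes_iM_i)$ for all Banach spaces $E_i$ and all $z\in\otimes_iE_i$, the infimum being over all finite-dimensional subspaces $M_i\subseteq E_i$ with $z\in\otimes_iM_i$. The dual tensor norm $\alpha'$ is defined on finite-dimensional spaces by $(\otimes_iM_i,\alpha')=\big[(\otimes_iM_i',\alpha)\big]'$ isometrically, and on arbitrary Banach spaces by $\alpha'(z;\otimes_iE_i)=\inf\alpha'(z;\otimes_iM_i)$, with the infimum over the same tuples of subspaces. Write $(\widetilde\otimes_{i=1}^nE_i,\alpha)$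 for the completion of $(\otimes_{i=1}^nE_i,\alpha)$. For sets $J_1,\dots,J_n$ consider the canonical map $$(\widetilde\otimes_{i=1}^n\ell_1(J_i),\alpha)\longrightarrow\big(\widetilde\otimes_{i=1}^nc_0(J_i),\alpha'\big)',\qquad \langle a_1\otimes\cdots\otimes a_n,\;x_1\otimes\cdots\otimes x_n\rangle=\prod_{i=1}^n\sum_{j\in J_i}a_i(j)\,x_i(j).\tag{$*$}$$ We say that $\alpha$ has the sRN (symmetric Radon-Nikodým) property if $(*)$ is an isometric isomorphism when $J_1=\dots=J_n=\mathbb N$, that is, if $(\widetilde\otimes_{i=1}^n\ell_1,\alpha)=\big(\widetilde\otimes_{i=1}^nc_0,\alpha'\big)'$ isometrically. **Proposition.** Let $\alpha$ be a finitely generated full tensor norm of order $n$ with the sRN property. Then for all index sets $J_1,\dots,J_n$ the canonical map $(*)$ is an isometric isomorphism; that is, $(\widetilde\otimes_{i=1}^n\ell_1(J_i),\alpha)=\big(\widetilde\otimes_{i=1}^nc_0(J_i),\alpha'\big)'$ isometrically. -/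

import Mathlib

open scoped TensorProduct

universe u

noncomputable section

/-! ### The algebraic tensor product: pairing and injective norm -/

section Pairing

variable {𝕜 : Type} [RCLike 𝕜] {n : ℕ} {E F : Fin n → Type u}
  [∀ i, NormedAddCommGroup (E i)] [∀ i, NormedSpace 𝕜 (E i)]
  [∀ i, NormedAddCommGroup (F i)] [∀ i, NormedSpace 𝕜 (F i)]

/-- The canonical bilinear pairing between `⨂ E i'` and `⨂ E i`, given on elementary tensors by
`⟨⨂ φ i, ⨂ x i⟩ = ∏ i, φ i (x i)`. -/
def tensorPairing :
    (⨂[𝕜] i, StrongDual 𝕜 (E i)) →ₗ[𝕜] Module.Dual 𝕜 (⨂[𝕜] i, E i) :=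
  PiTensorProduct.dualDistrib ∘ₗ
    PiTensorProduct.map (fun i => (ContinuousLinearMap.coeLM 𝕜 : StrongDual 𝕜 (E i) →ₗ[𝕜] _))

@[simp]
theorem tensorPairing_tprod (φ : ∀ i, StrongDual 𝕜 (E i)) (x : ∀ i, E i) :
    tensorPairing (⨂ₜ[𝕜] i, φ i) (⨂ₜ[𝕜] i, x i) = ∏ i, φ i (x i) := by
  simp [tensorPairing]

/-- The injective norm `ε` on `⨂ E i`: the supremum of `|⟨⨂ φ i, z⟩|` over all functionals
`φ i` in the closed unit ball of the dual of `E i`. -/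
def injectiveTensorNorm (z : ⨂[𝕜] i, E i) : ℝ :=
  ⨆ φ : {φ : ∀ i, StrongDual 𝕜 (E i) // ∀ i, ‖φ i‖ ≤ 1}, ‖tensorPairing (⨂ₜ[𝕜] i, φ.1 i) z‖

theorem bddAbove_injectiveTensorNorm (z : ⨂[𝕜] i, E i) :
    BddAbove (Set.range fun φ : {φ : ∀ i, StrongDual 𝕜 (E i) // ∀ i, ‖φ i‖ ≤ 1} =>
      ‖tensorPairing (⨂ₜ[𝕜] i, φ.1 i) z‖) := by
  induction z using PiTensorProduct.induction_on with
  | smul_tprod r x =>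
    refine ⟨‖r‖ * ∏ i, ‖x i‖, ?_⟩
    rintro _ ⟨φ, rfl⟩
    simp only [map_smul, tensorPairing_tprod, norm_smul, norm_prod]
    refine mul_le_mul_of_nonneg_left ?_ (norm_nonneg _)
    refine Finset.prod_le_prod (fun _ _ => norm_nonneg _) fun i _ => ?_
    calc ‖φ.1 i (x i)‖ ≤ ‖φ.1 i‖ * ‖x i‖ := (φ.1 i).le_opNorm _
      _ ≤ 1 * ‖x i‖ := by gcongr; exact φ.2 i
      _ = ‖x i‖ := one_mul _
  | add x y hx hy =>
    obtain ⟨a, ha⟩ := hx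
    obtain ⟨b, hb⟩ := hy
    refine ⟨a + b, ?_⟩
    rintro _ ⟨φ, rfl⟩
    simp only [map_add]
    exact (norm_add_le _ _).trans (add_le_add (ha ⟨φ, rfl⟩) (hb ⟨φ, rfl⟩))

theorem norm_tensorPairing_tprod_le (φ : ∀ i, StrongDual 𝕜 (E i)) (z : ⨂[𝕜] i, E i) :
    ‖tensorPairing (⨂ₜ[𝕜] i, φ i) z‖ ≤ (∏ i, ‖φ i‖) * injectiveTensorNorm z := by
  by_cases h0 : ∃ i, φ i = 0
  · obtain ⟨i, hi⟩ := h0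
    have h1 : (⨂ₜ[𝕜] i, φ i) = 0 := (PiTensorProduct.tprod 𝕜).map_coord_zero i hi
    have h2 : ∏ i, ‖φ i‖ = 0 := Finset.prod_eq_zero (Finset.mem_univ i) (by simp [hi])
    rw [h1, h2]
    simp
  · push Not at h0
    let ψ : ∀ i, StrongDual 𝕜 (E i) := fun i => ((‖φ i‖⁻¹ : ℝ) : 𝕜) • φ i
    have hψ : ∀ i, ‖ψ i‖ ≤ 1 := fun i => by
      have : ‖φ i‖ ≠ 0 := norm_ne_zero_iff.2 (h0 i)
      simp [ψ, norm_smul, this]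
    have h1 : φ = fun i => ((‖φ i‖ : ℝ) : 𝕜) • ψ i := by
      funext i
      have : (‖φ i‖ : 𝕜) ≠ 0 := by
        exact_mod_cast norm_ne_zero_iff.2 (h0 i)
      simp [ψ, smul_smul, this]
    have h2 : (⨂ₜ[𝕜] i, φ i) = (∏ i, ((‖φ i‖ : ℝ) : 𝕜)) • ⨂ₜ[𝕜] i, ψ i := by
      conv_lhs => rw [h1]
      exact MultilinearMap.map_smul_univ _ _ _
    rw [h2, map_smul, LinearMap.smul_apply, norm_smul, norm_prod]
    simp only [RCLike.norm_ofReal, abs_norm]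
    refine mul_le_mul_of_nonneg_left ?_ (Finset.prod_nonneg fun _ _ => norm_nonneg _)
    exact le_ciSup (bddAbove_injectiveTensorNorm z)
      (⟨ψ, hψ⟩ : {φ : ∀ i, StrongDual 𝕜 (E i) // ∀ i, ‖φ i‖ ≤ 1})

theorem injectiveTensorNorm_nonneg (z : ⨂[𝕜] i, E i) : 0 ≤ injectiveTensorNorm z :=
  Real.iSup_nonneg fun _ => norm_nonneg _

theorem exists_fin_rep (z : ⨂[𝕜] i, E i) :
    ∃ (M : ∀ i, Submodule 𝕜 (E i)) (_ : ∀ i, FiniteDimensional 𝕜 (M i)) (w : ⨂[𝕜] i, M i),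
      PiTensorProduct.mapIncl M w = z := by
  induction z using PiTensorProduct.induction_on with
  | smul_tprod r x =>
    refine ⟨fun i => 𝕜 ∙ x i, fun i => inferInstance,
      r • ⨂ₜ[𝕜] i, ⟨x i, Submodule.mem_span_singleton_self _⟩, ?_⟩
    simp [PiTensorProduct.mapIncl]
  | add x y hx hy =>
    obtain ⟨M, hM, v, rfl⟩ := hx
    obtain ⟨N, hN, w, rfl⟩ := hy
    refine ⟨fun i => M i ⊔ N i, fun i => inferInstance,
      PiTensorProduct.map (fun i => Submodule.inclusion (le_sup_left : M i ≤ M i ⊔ N i)) v +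
      PiTensorProduct.map (fun i => Submodule.inclusion (le_sup_right : N i ≤ M i ⊔ N i)) w, ?_⟩
    rw [map_add]
    simp only [PiTensorProduct.mapIncl, ← LinearMap.comp_apply, ← PiTensorProduct.map_comp]
    simp only [Submodule.subtype_comp_inclusion]

theorem tensorPairing_mapIncl (M : ∀ i, Submodule 𝕜 (E i)) (φ : ∀ i, StrongDual 𝕜 (E i))
    (w : ⨂[𝕜] i, M i) :
    tensorPairing (⨂ₜ[𝕜] i, φ i) (PiTensorProduct.mapIncl M w) =
      tensorPairing (⨂ₜ[𝕜] i, (φ i).comp (M i).subtypeL) w := by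
  induction w using PiTensorProduct.induction_on with
  | smul_tprod r x => simp [PiTensorProduct.mapIncl]
  | add x y hx hy => simp only [map_add, hx, hy]

theorem eq_zero_of_injectiveTensorNorm_le_zero {z : ⨂[𝕜] i, E i}
    (hz : injectiveTensorNorm z ≤ 0) : z = 0 := by
  obtain ⟨M, hM, w, rfl⟩ := exists_fin_rep z
  let b := fun i => Module.finBasis 𝕜 (M i)
  suffices w = 0 by simp [this]
  have key : ∀ p, (Basis.piTensorProduct b).repr w p = 0 := by
    intro p
    have hext : ∀ i, ∃ g : StrongDual 𝕜 (E i),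
        ∀ x : M i, g x = (b i).repr x (p i) := fun i => by
      obtain ⟨g, hg, -⟩ := exists_extension_norm_eq (M i)
        (LinearMap.toContinuousLinearMap ((b i).coord (p i)))
      exact ⟨g, fun x => by simp [hg]⟩
    choose g hg using hext
    have h1 : tensorPairing (⨂ₜ[𝕜] i, g i) (PiTensorProduct.mapIncl M w) = 0 := by
      rw [← norm_le_zero_iff]
      refine (norm_tensorPairing_tprod_le g _).trans ?_
      exact mul_nonpos_of_nonneg_of_nonpos (Finset.prod_nonneg fun _ _ => norm_nonneg _) hz
    rw [tensorPairing_mapIncl] at h1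
    rw [← h1]
    clear h1 hz
    induction w using PiTensorProduct.induction_on with
    | smul_tprod r x =>
      simp [hg]
    | add x y hx hy => simp only [map_add, Finsupp.add_apply, hx, hy]
  exact (Basis.piTensorProduct b).ext_elem fun p => by simp [key p]

/-- Tensoring operators is dual to tensoring their adjoints. -/
theorem tensorPairing_map (T : ∀ i, E i →L[𝕜] F i) (w : ⨂[𝕜] i, StrongDual 𝕜 (F i))
    (z : ⨂[𝕜] i, E i) :
    tensorPairing w (PiTensorProduct.map (fun i => (T i).toLinearMap) z) =
      tensorPairing
        (PiTensorProduct.map (fun i => (ContinuousLinearMap.precomp 𝕜 (T i)).toLinearMap) w) z := by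
  induction w using PiTensorProduct.induction_on with
  | smul_tprod s φ =>
    induction z using PiTensorProduct.induction_on with
    | smul_tprod r x => simp
    | add x y hx hy => simp only [map_add, hx, hy]
  | add x y hx hy => simp only [map_add, LinearMap.add_apply, hx, hy]

/-- A seminorm dominated by `∏ ‖x i‖` on elementary tensors is dominated by the projective
norm, which is the norm that Mathlib puts on `⨂ E i`. -/
theorem seminorm_le_projective (p : Seminorm 𝕜 (⨂[𝕜] i, E i))
    (hp : ∀ x : ∀ i, E i, p (⨂ₜ[𝕜] i, x i) ≤ ∏ i, ‖x i‖) (z : ⨂[𝕜] i, E i) :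
    p z ≤ PiTensorProduct.projectiveSeminorm z := by
  change p z ≤ ‖z‖
  rw [PiTensorProduct.norm_def]
  have : Nonempty (PiTensorProduct.lifts z) := (PiTensorProduct.nonempty_lifts z).to_subtype
  refine le_ciInf ?_
  rintro ⟨q, hq⟩
  rw [PiTensorProduct.mem_lifts_iff] at hq
  subst hq
  simp only [PiTensorProduct.projectiveSeminormAux]
  generalize FreeAddMonoid.toList q = l
  induction l with
  | nil => simp
  | cons a l ih =>
    simp only [List.map_cons, List.sum_cons]
    refine (map_add_le_add p _ _).trans (add_le_add ?_ ih)
    rw [map_smul_eq_mul]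
    exact mul_le_mul_of_nonneg_left (hp _) (norm_nonneg _)

end Pairing

/-! ### Full tensor norms -/

/-- A full tensor norm of order `n`: an assignment of a norm on the algebraic tensor product
`E 1 ⊗ ⋯ ⊗ E n` to every `n`-tuple of Banach spaces, lying between the injective norm `ε` and the
projective norm `π`, and satisfying the metric mapping property. -/
structure FullTensorNorm (𝕜 : Type) [RCLike 𝕜] (n : ℕ) where
  /-- the norm on `⨂ E i` -/
  norm : ∀ (E : Fin n → Type u) [∀ i, NormedAddCommGroup (E i)] [∀ i, NormedSpace 𝕜 (E i)]
    [∀ i, CompleteSpace (E i)], Seminorm 𝕜 (⨂[𝕜] i, E i)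
  eq_zero : ∀ (E : Fin n → Type u) [∀ i, NormedAddCommGroup (E i)] [∀ i, NormedSpace 𝕜 (E i)]
    [∀ i, CompleteSpace (E i)] (z : ⨂[𝕜] i, E i), norm E z = 0 → z = 0
  injective_le : ∀ (E : Fin n → Type u) [∀ i, NormedAddCommGroup (E i)]
    [∀ i, NormedSpace 𝕜 (E i)] [∀ i, CompleteSpace (E i)] (z : ⨂[𝕜] i, E i),
    injectiveTensorNorm z ≤ norm E z
  le_projective : ∀ (E : Fin n → Type u) [∀ i, NormedAddCommGroup (E i)]
    [∀ i, NormedSpace 𝕜 (E i)] [∀ i, CompleteSpace (E i)] (z : ⨂[𝕜] i, E i),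
    norm E z ≤ PiTensorProduct.projectiveSeminorm z
  map_le : ∀ (E F : Fin n → Type u) [∀ i, NormedAddCommGroup (E i)]
    [∀ i, NormedSpace 𝕜 (E i)] [∀ i, CompleteSpace (E i)] [∀ i, NormedAddCommGroup (F i)]
    [∀ i, NormedSpace 𝕜 (F i)] [∀ i, CompleteSpace (F i)] (T : ∀ i, E i →L[𝕜] F i)
    (z : ⨂[𝕜] i, E i),
    norm F (PiTensorProduct.map (fun i => (T i).toLinearMap) z) ≤ (∏ i, ‖T i‖) * norm E z

/-- Given a function `β` on the tensor products of all tuples of finite-dimensional normed spaces,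
the infimum of `β (z; ⨂ M i)` over all tuples of finite-dimensional subspaces `M i` of `E i` whose
tensor product contains `z`. -/
def finiteHull {𝕜 : Type} [RCLike 𝕜] {n : ℕ}
    (β : ∀ (M : Fin n → Type u) [∀ i, NormedAddCommGroup (M i)] [∀ i, NormedSpace 𝕜 (M i)]
      [∀ i, FiniteDimensional 𝕜 (M i)], (⨂[𝕜] i, M i) → ℝ)
    (E : Fin n → Type u) [∀ i, NormedAddCommGroup (E i)] [∀ i, NormedSpace 𝕜 (E i)]
    (z : ⨂[𝕜] i, E i) : ℝ :=
  sInf {r : ℝ | ∃ (M : ∀ i, Submodule 𝕜 (E i)) (_ : ∀ i, FiniteDimensional 𝕜 (M i))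
    (w : ⨂[𝕜] i, M i), PiTensorProduct.mapIncl M w = z ∧ β (fun i => M i) w = r}

namespace FullTensorNorm

variable {𝕜 : Type} [RCLike 𝕜] {n : ℕ}

/-- The restriction of a tensor norm to finite-dimensional spaces, which are all complete. -/
def onFin (α : FullTensorNorm.{u} 𝕜 n) (M : Fin n → Type u) [∀ i, NormedAddCommGroup (M i)]
    [∀ i, NormedSpace 𝕜 (M i)] [∀ i, FiniteDimensional 𝕜 (M i)] (z : ⨂[𝕜] i, M i) : ℝ :=
  haveI : ∀ i, CompleteSpace (M i) := fun i => FiniteDimensional.complete 𝕜 (M i)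
  α.norm M z

/-- `α` is finitely generated: its value at `z ∈ ⨂ E i` is the infimum of its values at `z` as an
element of `⨂ M i`, over finite-dimensional subspaces `M i` of `E i`. -/
def IsFinitelyGenerated (α : FullTensorNorm.{u} 𝕜 n) : Prop :=
  ∀ (E : Fin n → Type u) [∀ i, NormedAddCommGroup (E i)] [∀ i, NormedSpace 𝕜 (E i)]
    [∀ i, CompleteSpace (E i)] (z : ⨂[𝕜] i, E i), α.norm E z = finiteHull α.onFin E z

/-- The dual tensor norm on tuples of finite-dimensional spaces: `(⨂ M i, α')` is the dual of
`(⨂ M i', α)`, so `α' (z)` is the supremum of `|⟨w, z⟩|` over the closed `α`-unit ball of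
`⨂ M i'`. -/
def dualOnFin (α : FullTensorNorm.{u} 𝕜 n) (M : Fin n → Type u) [∀ i, NormedAddCommGroup (M i)]
    [∀ i, NormedSpace 𝕜 (M i)] [∀ i, FiniteDimensional 𝕜 (M i)] (z : ⨂[𝕜] i, M i) : ℝ :=
  ⨆ w : {w : ⨂[𝕜] i, StrongDual 𝕜 (M i) // α.norm (fun i => StrongDual 𝕜 (M i)) w ≤ 1},
    ‖tensorPairing w.1 z‖

section Finite

variable (α : FullTensorNorm.{u} 𝕜 n) {M N : Fin n → Type u} [∀ i, NormedAddCommGroup (M i)]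
  [∀ i, NormedSpace 𝕜 (M i)] [∀ i, FiniteDimensional 𝕜 (M i)] [∀ i, NormedAddCommGroup (N i)]
  [∀ i, NormedSpace 𝕜 (N i)] [∀ i, FiniteDimensional 𝕜 (N i)]

theorem norm_tensorPairing_le_prod (w : ⨂[𝕜] i, StrongDual 𝕜 (M i)) (x : ∀ i, M i) :
    ‖tensorPairing w (⨂ₜ[𝕜] i, x i)‖ ≤
      α.norm (fun i => StrongDual 𝕜 (M i)) w * ∏ i, ‖x i‖ := by
  have h1 : tensorPairing w (⨂ₜ[𝕜] i, x i) =
      tensorPairing (⨂ₜ[𝕜] i, NormedSpace.inclusionInDoubleDual 𝕜 (M i) (x i)) w := by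
    induction w using PiTensorProduct.induction_on with
    | smul_tprod s φ => simp
    | add v w hv hw => simp only [map_add, LinearMap.add_apply, hv, hw]
  rw [h1, mul_comm]
  refine (norm_tensorPairing_tprod_le _ w).trans ?_
  refine mul_le_mul ?_ (α.injective_le _ w) (injectiveTensorNorm_nonneg _)
    (Finset.prod_nonneg fun _ _ => norm_nonneg _)
  exact Finset.prod_le_prod (fun _ _ => norm_nonneg _)
    fun i _ => NormedSpace.double_dual_bound 𝕜 (M i) (x i)

theorem bddAbove_dualOnFin (z : ⨂[𝕜] i, M i) :
    BddAbove (Set.range fun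
      w : {w : ⨂[𝕜] i, StrongDual 𝕜 (M i) // α.norm (fun i => StrongDual 𝕜 (M i)) w ≤ 1} =>
      ‖tensorPairing w.1 z‖) := by
  induction z using PiTensorProduct.induction_on with
  | smul_tprod r x =>
    refine ⟨‖r‖ * ∏ i, ‖x i‖, ?_⟩
    rintro _ ⟨w, rfl⟩
    simp only [map_smul, norm_smul]
    refine mul_le_mul_of_nonneg_left ?_ (norm_nonneg _)
    exact (α.norm_tensorPairing_le_prod w.1 x).trans
      (mul_le_of_le_one_left (Finset.prod_nonneg fun _ _ => norm_nonneg _) w.2)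
  | add x y hx hy =>
    obtain ⟨a, ha⟩ := hx
    obtain ⟨b, hb⟩ := hy
    refine ⟨a + b, ?_⟩
    rintro _ ⟨φ, rfl⟩
    simp only [map_add]
    exact (norm_add_le _ _).trans (add_le_add (ha ⟨φ, rfl⟩) (hb ⟨φ, rfl⟩))

theorem dualOnFin_nonneg (z : ⨂[𝕜] i, M i) : 0 ≤ α.dualOnFin M z :=
  Real.iSup_nonneg fun _ => norm_nonneg _

theorem norm_tensorPairing_le (w : ⨂[𝕜] i, StrongDual 𝕜 (M i)) (z : ⨂[𝕜] i, M i) :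
    ‖tensorPairing w z‖ ≤ α.norm (fun i => StrongDual 𝕜 (M i)) w * α.dualOnFin M z := by
  set a := α.norm (fun i => StrongDual 𝕜 (M i)) w with ha
  by_cases h0 : a = 0
  · rw [α.eq_zero _ w h0]
    simp [h0]
  have hpos : 0 < a := lt_of_le_of_ne (apply_nonneg _ _) (Ne.symm h0)
  have h1 : α.norm (fun i => StrongDual 𝕜 (M i)) (((a⁻¹ : ℝ) : 𝕜) • w) ≤ 1 := by
    rw [map_smul_eq_mul, ← ha, RCLike.norm_ofReal, abs_of_pos (inv_pos.2 hpos),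
      inv_mul_cancel₀ h0]
  have h2 : ‖tensorPairing (((a⁻¹ : ℝ) : 𝕜) • w) z‖ ≤ α.dualOnFin M z :=
    le_ciSup (α.bddAbove_dualOnFin z) ⟨_, h1⟩
  rw [map_smul, LinearMap.smul_apply, norm_smul, RCLike.norm_ofReal,
    abs_of_pos (inv_pos.2 hpos), inv_mul_le_iff₀ hpos] at h2
  exact h2

theorem dualOnFin_le {z : ⨂[𝕜] i, M i} {C : ℝ} (hC : 0 ≤ C)
    (h : ∀ w : ⨂[𝕜] i, StrongDual 𝕜 (M i), α.norm (fun i => StrongDual 𝕜 (M i)) w ≤ 1 →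
      ‖tensorPairing w z‖ ≤ C) : α.dualOnFin M z ≤ C :=
  Real.iSup_le (fun w => h w.1 w.2) hC

theorem dualOnFin_add_le (x y : ⨂[𝕜] i, M i) :
    α.dualOnFin M (x + y) ≤ α.dualOnFin M x + α.dualOnFin M y := by
  refine α.dualOnFin_le (add_nonneg (α.dualOnFin_nonneg _) (α.dualOnFin_nonneg _)) fun w hw => ?_
  rw [map_add]
  exact (norm_add_le _ _).trans (add_le_add (le_ciSup (α.bddAbove_dualOnFin x) ⟨w, hw⟩)
    (le_ciSup (α.bddAbove_dualOnFin y) ⟨w, hw⟩))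

theorem dualOnFin_smul_le (r : 𝕜) (x : ⨂[𝕜] i, M i) :
    α.dualOnFin M (r • x) ≤ ‖r‖ * α.dualOnFin M x := by
  refine α.dualOnFin_le (mul_nonneg (norm_nonneg _) (α.dualOnFin_nonneg _)) fun w hw => ?_
  rw [map_smul, norm_smul]
  exact mul_le_mul_of_nonneg_left (le_ciSup (α.bddAbove_dualOnFin x) ⟨w, hw⟩) (norm_nonneg _)

theorem dualOnFin_map_le (T : ∀ i, M i →L[𝕜] N i) (C : Fin n → ℝ) (hT : ∀ i, ‖T i‖ ≤ C i)
    (z : ⨂[𝕜] i, M i) :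
    α.dualOnFin N (PiTensorProduct.map (fun i => (T i).toLinearMap) z) ≤
      (∏ i, C i) * α.dualOnFin M z := by
  have hC : ∀ i, 0 ≤ C i := fun i => (norm_nonneg _).trans (hT i)
  have hP : 0 ≤ ∏ i, C i := Finset.prod_nonneg fun i _ => hC i
  refine α.dualOnFin_le (mul_nonneg hP (α.dualOnFin_nonneg _)) fun w hw => ?_
  rw [tensorPairing_map]
  refine (α.norm_tensorPairing_le _ z).trans ?_
  refine mul_le_mul_of_nonneg_right ?_ (α.dualOnFin_nonneg _)
  refine (α.map_le (fun i => StrongDual 𝕜 (N i)) (fun i => StrongDual 𝕜 (M i))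
    (fun i => ContinuousLinearMap.precomp 𝕜 (T i)) w).trans ?_
  refine (mul_le_mul ?_ hw (apply_nonneg _ _) hP).trans (mul_one _).le
  refine Finset.prod_le_prod (fun _ _ => norm_nonneg _) fun i _ => ?_
  refine ContinuousLinearMap.opNorm_le_bound _ (hC i) fun φ => ?_
  rw [mul_comm]
  exact (ContinuousLinearMap.opNorm_comp_le φ (T i)).trans
    (mul_le_mul_of_nonneg_left (hT i) (norm_nonneg _))

end Finite

section Extension

variable (α : FullTensorNorm.{u} 𝕜 n) {E F : Fin n → Type u} [∀ i, NormedAddCommGroup (E i)]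
  [∀ i, NormedSpace 𝕜 (E i)] [∀ i, NormedAddCommGroup (F i)] [∀ i, NormedSpace 𝕜 (F i)]

theorem finiteHull_dual_le (M : ∀ i, Submodule 𝕜 (E i)) [hM : ∀ i, FiniteDimensional 𝕜 (M i)]
    (w : ⨂[𝕜] i, M i) :
    finiteHull α.dualOnFin E (PiTensorProduct.mapIncl M w) ≤ α.dualOnFin (fun i => M i) w := by
  refine csInf_le ⟨0, ?_⟩ ⟨M, hM, w, rfl, rfl⟩
  rintro _ ⟨M, hM, w, -, rfl⟩
  exact α.dualOnFin_nonneg w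

theorem le_finiteHull_dual {z : ⨂[𝕜] i, E i} {c : ℝ}
    (h : ∀ (M : ∀ i, Submodule 𝕜 (E i)) [∀ i, FiniteDimensional 𝕜 (M i)] (w : ⨂[𝕜] i, M i),
      PiTensorProduct.mapIncl M w = z → c ≤ α.dualOnFin (fun i => M i) w) :
    c ≤ finiteHull α.dualOnFin E z := by
  obtain ⟨M, hM, w, hw⟩ := exists_fin_rep z
  refine le_csInf ⟨_, M, hM, w, hw, rfl⟩ ?_
  rintro _ ⟨M, hM, w, hw, rfl⟩
  exact h M w hw

theorem finiteHull_dual_add_le (x y : ⨂[𝕜] i, E i) :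
    finiteHull α.dualOnFin E (x + y) ≤
      finiteHull α.dualOnFin E x + finiteHull α.dualOnFin E y := by
  rw [← sub_le_iff_le_add]
  refine α.le_finiteHull_dual fun M hM v hv => ?_
  rw [sub_le_iff_le_add, ← sub_le_iff_le_add']
  refine α.le_finiteHull_dual fun N hN w hw => ?_
  rw [sub_le_iff_le_add']
  let S : ∀ i, M i →L[𝕜] (M i ⊔ N i : Submodule 𝕜 (E i)) := fun i =>
    LinearMap.mkContinuous (Submodule.inclusion le_sup_left) 1 fun x => by simp
  let T : ∀ i, N i →L[𝕜] (M i ⊔ N i : Submodule 𝕜 (E i)) := fun i =>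
    LinearMap.mkContinuous (Submodule.inclusion le_sup_right) 1 fun x => by simp
  have hS : ∀ i, ‖S i‖ ≤ 1 := fun i => LinearMap.mkContinuous_norm_le _ zero_le_one _
  have hT : ∀ i, ‖T i‖ ≤ 1 := fun i => LinearMap.mkContinuous_norm_le _ zero_le_one _
  have h1 := α.dualOnFin_map_le S (fun _ => 1) hS v
  have h2 := α.dualOnFin_map_le T (fun _ => 1) hT w
  simp only [Finset.prod_const_one, one_mul] at h1 h2
  have h3 : PiTensorProduct.mapIncl (fun i => M i ⊔ N i)
      (PiTensorProduct.map (fun i => (S i).toLinearMap) v +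
        PiTensorProduct.map (fun i => (T i).toLinearMap) w) = x + y := by
    rw [map_add, ← hv, ← hw]
    simp only [PiTensorProduct.mapIncl, ← LinearMap.comp_apply, ← PiTensorProduct.map_comp]
    rfl
  rw [← h3]
  exact (α.finiteHull_dual_le _ _).trans ((α.dualOnFin_add_le _ _).trans (add_le_add h1 h2))

theorem finiteHull_dual_smul_le (r : 𝕜) (x : ⨂[𝕜] i, E i) :
    finiteHull α.dualOnFin E (r • x) ≤ ‖r‖ * finiteHull α.dualOnFin E x := by
  have key : ∀ (M : ∀ i, Submodule 𝕜 (E i)) [∀ i, FiniteDimensional 𝕜 (M i)] (w : ⨂[𝕜] i, M i),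
      PiTensorProduct.mapIncl M w = x →
      finiteHull α.dualOnFin E (r • x) ≤ ‖r‖ * α.dualOnFin (fun i => M i) w := by
    intro M hM w hw
    rw [← hw, ← map_smul]
    exact (α.finiteHull_dual_le M _).trans (α.dualOnFin_smul_le r w)
  by_cases hr : r = 0
  · obtain ⟨M, hM, w, hw⟩ := exists_fin_rep x
    simpa [hr] using key M w hw
  · have hpos : 0 < ‖r‖ := norm_pos_iff.2 hr
    rw [← inv_mul_le_iff₀ hpos]
    refine α.le_finiteHull_dual fun M hM w hw => ?_
    rw [inv_mul_le_iff₀ hpos]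
    exact key M w hw

theorem finiteHull_dual_zero : finiteHull α.dualOnFin E 0 = 0 := by
  refine le_antisymm ?_ (α.le_finiteHull_dual fun M hM w _ => α.dualOnFin_nonneg w)
  have := α.finiteHull_dual_smul_le (0 : 𝕜) (0 : ⨂[𝕜] i, E i)
  simpa using this

theorem injective_le_finiteHull_dual (z : ⨂[𝕜] i, E i) :
    injectiveTensorNorm z ≤ finiteHull α.dualOnFin E z := by
  refine α.le_finiteHull_dual fun M hM w hw => ?_
  refine Real.iSup_le (fun φ => ?_) (α.dualOnFin_nonneg w)
  rw [← hw, tensorPairing_mapIncl]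
  refine le_ciSup (α.bddAbove_dualOnFin w) ⟨⨂ₜ[𝕜] i, (φ.1 i).comp (M i).subtypeL, ?_⟩
  refine (α.le_projective _ _).trans ((PiTensorProduct.projectiveSeminorm_tprod_le _).trans ?_)
  refine Finset.prod_le_one (fun _ _ => norm_nonneg _) fun i _ => ?_
  refine (ContinuousLinearMap.opNorm_comp_le _ _).trans ?_
  exact mul_le_one₀ (φ.2 i) (norm_nonneg _) (Submodule.norm_subtypeL_le _)

theorem finiteHull_dual_tprod_le (x : ∀ i, E i) :
    finiteHull α.dualOnFin E (⨂ₜ[𝕜] i, x i) ≤ ∏ i, ‖x i‖ := by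
  let M : ∀ i, Submodule 𝕜 (E i) := fun i => 𝕜 ∙ x i
  let y : ∀ i, M i := fun i => ⟨x i, Submodule.mem_span_singleton_self _⟩
  have h1 : PiTensorProduct.mapIncl M (⨂ₜ[𝕜] i, y i) = ⨂ₜ[𝕜] i, x i := by
    simp [PiTensorProduct.mapIncl, y]
  rw [← h1]
  refine (α.finiteHull_dual_le M _).trans ?_
  have hP : 0 ≤ ∏ i, ‖x i‖ := Finset.prod_nonneg fun _ _ => norm_nonneg _
  refine α.dualOnFin_le hP fun w hw => ?_
  exact (α.norm_tensorPairing_le_prod w y).trans (mul_le_of_le_one_left hP hw)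

theorem finiteHull_dual_map_le (T : ∀ i, E i →L[𝕜] F i) (z : ⨂[𝕜] i, E i) :
    finiteHull α.dualOnFin F (PiTensorProduct.map (fun i => (T i).toLinearMap) z) ≤
      (∏ i, ‖T i‖) * finiteHull α.dualOnFin E z := by
  have key : ∀ (M : ∀ i, Submodule 𝕜 (E i)) [∀ i, FiniteDimensional 𝕜 (M i)] (w : ⨂[𝕜] i, M i),
      PiTensorProduct.mapIncl M w = z →
      finiteHull α.dualOnFin F (PiTensorProduct.map (fun i => (T i).toLinearMap) z) ≤
        (∏ i, ‖T i‖) * α.dualOnFin (fun i => M i) w := by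
    intro M hM w hw
    let N : ∀ i, Submodule 𝕜 (F i) := fun i => (M i).map (T i).toLinearMap
    let S : ∀ i, M i →L[𝕜] N i := fun i =>
      ((T i).comp (M i).subtypeL).codRestrict (N i) fun x => ⟨x, x.2, rfl⟩
    have hS : ∀ i, ‖S i‖ ≤ ‖T i‖ := fun i =>
      ContinuousLinearMap.opNorm_le_bound _ (norm_nonneg _) fun x => (T i).le_opNorm x
    have h3 : PiTensorProduct.mapIncl N (PiTensorProduct.map (fun i => (S i).toLinearMap) w) =
        PiTensorProduct.map (fun i => (T i).toLinearMap) z := by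
      rw [← hw]
      simp only [PiTensorProduct.mapIncl, ← LinearMap.comp_apply, ← PiTensorProduct.map_comp]
      rfl
    rw [← h3]
    exact (α.finiteHull_dual_le N _).trans (α.dualOnFin_map_le S _ hS w)
  have hP : 0 ≤ ∏ i, ‖T i‖ := Finset.prod_nonneg fun _ _ => norm_nonneg _
  rcases hP.eq_or_lt with h0 | hpos
  · obtain ⟨M, hM, w, hw⟩ := exists_fin_rep z
    have := key M w hw
    rwa [← h0, zero_mul] at this ⊢
  · rw [← inv_mul_le_iff₀ hpos]
    refine α.le_finiteHull_dual fun M hM w hw => ?_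
    rw [inv_mul_le_iff₀ hpos]
    exact key M w hw

end Extension

/-- The dual tensor norm `α'`: on finite-dimensional spaces `(⨂ M i, α')` is the dual of
`(⨂ M i', α)`, and `α'` is extended to all Banach spaces by taking the infimum over
finite-dimensional subspaces. -/
def dual (α : FullTensorNorm.{u} 𝕜 n) : FullTensorNorm.{u} 𝕜 n where
  norm E _ _ _ := Seminorm.ofSMulLE (finiteHull α.dualOnFin E) α.finiteHull_dual_zero
    α.finiteHull_dual_add_le α.finiteHull_dual_smul_le
  eq_zero _ _ _ _ _ hz := eq_zero_of_injectiveTensorNorm_le_zero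
    ((α.injective_le_finiteHull_dual _).trans (le_of_eq hz))
  injective_le _ _ _ _ z := α.injective_le_finiteHull_dual z
  le_projective _ _ _ _ z := seminorm_le_projective _ α.finiteHull_dual_tprod_le z
  map_le _ _ _ _ _ _ _ _ T z := α.finiteHull_dual_map_le T z

/-! ### Completed tensor products -/

section Completed

variable (α : FullTensorNorm.{u} 𝕜 n) (E : Fin n → Type u) [∀ i, NormedAddCommGroup (E i)]
  [∀ i, NormedSpace 𝕜 (E i)] [∀ i, CompleteSpace (E i)]

/-- The algebraic tensor product `⨂ E i`, to be normed by `α`. It is a copy because Mathlib's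
norm on `⨂[𝕜] i, E i` is the projective one. -/
def Space (_α : FullTensorNorm.{u} 𝕜 n) (E : Fin n → Type u) [∀ i, NormedAddCommGroup (E i)]
    [∀ i, NormedSpace 𝕜 (E i)] [∀ i, CompleteSpace (E i)] : Type u :=
  ⨂[𝕜] i, E i

instance : AddCommGroup (α.Space E) := inferInstanceAs (AddCommGroup (⨂[𝕜] i, E i))

instance : Module 𝕜 (α.Space E) := inferInstanceAs (Module 𝕜 (⨂[𝕜] i, E i))

instance : NormedAddCommGroup (α.Space E) :=
  AddGroupNorm.toNormedAddCommGroup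
    { toFun := fun z : α.Space E => α.norm E z
      map_zero' := map_zero (α.norm E)
      add_le' := map_add_le_add (α.norm E)
      neg' := map_neg_eq_map (α.norm E)
      eq_zero_of_map_eq_zero' := α.eq_zero E }

instance : NormedSpace 𝕜 (α.Space E) where
  norm_smul_le r z := le_of_eq (map_smul_eq_mul (α.norm E) r z)

/-- The completed tensor product of the `E i` with respect to `α`. -/
abbrev Completed : Type u := UniformSpace.Completion (α.Space E)

variable {E}

/-- The elementary tensor `x 1 ⊗ ⋯ ⊗ x n` in the completed tensor product. -/
def elementary (x : ∀ i, E i) : α.Completed E :=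
  ((show α.Space E from ⨂ₜ[𝕜] i, x i : α.Space E) : UniformSpace.Completion (α.Space E))

end Completed

end FullTensorNorm

/-! ### The spaces `ℓ₁(J)` and `c₀(J)`, and the property sRN -/

section SequenceSpaces

variable (𝕜 : Type) [RCLike 𝕜] (J : Type u)

/-- `ℓ₁(J)`, the Banach space of absolutely summable scalar families indexed by `J`. -/
abbrev EllOne : Type u := lp (fun _ : J => 𝕜) 1

/-- `c₀(J)`, the Banach space of scalar families indexed by `J` that tend to zero along the
cofinite filter, with the supremum norm: these are the functions on the discrete space `J` that
vanish at infinity. -/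
def CZero : Type u := @ZeroAtInftyContinuousMap J 𝕜 ⊥ _ _

instance : NormedAddCommGroup (CZero 𝕜 J) :=
  @ZeroAtInftyContinuousMap.instNormedAddCommGroup J 𝕜 ⊥ _

instance : NormedSpace 𝕜 (CZero 𝕜 J) :=
  @ZeroAtInftyContinuousMap.instNormedSpace J 𝕜 ⊥ _ 𝕜 _ _

instance : CompleteSpace (CZero 𝕜 J) :=
  @ZeroAtInftyContinuousMap.instCompleteSpace J 𝕜 ⊥ _ _ _

instance : FunLike (CZero 𝕜 J) J 𝕜 :=
  @ZeroAtInftyContinuousMap.instFunLike J 𝕜 ⊥ _ _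

end SequenceSpaces

namespace FullTensorNorm

variable {𝕜 : Type} [RCLike 𝕜] {n : ℕ}

/-- The canonical map from the completed `α`-tensor product of the `ℓ₁(J i)` to the dual of the
completed `α'`-tensor product of the `c₀(J i)`, determined by
`⟨a 1 ⊗ ⋯ ⊗ a n, x 1 ⊗ ⋯ ⊗ x n⟩ = ∏ i, ∑ j, a i j * x i j`, is an isometric isomorphism. -/
def CanonicalDuality (α : FullTensorNorm.{u} 𝕜 n) (J : Fin n → Type u) : Prop :=
  ∃ Φ : α.Completed (fun i => EllOne 𝕜 (J i)) ≃ₗᵢ[𝕜]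
      StrongDual 𝕜 (α.dual.Completed (fun i => CZero 𝕜 (J i))),
    ∀ (a : ∀ i, EllOne 𝕜 (J i)) (x : ∀ i, CZero 𝕜 (J i)),
      Φ (α.elementary a) (α.dual.elementary x) = ∏ i, ∑' j : J i, a i j * x i j

/-- The symmetric Radon-Nikodým property: the canonical map is an isometric isomorphism from
`⨂ ℓ₁`, completed for `α`, onto the dual of `⨂ c₀`, completed for `α'`. -/
def HasSRN (α : FullTensorNorm.{u} 𝕜 n) : Prop :=
  α.CanonicalDuality (fun _ => ULift.{u} ℕ)

end FullTensorNorm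

end

/-! Everything is reduced to countable index sets. A partial bijection between index sets induces
contractions, by relabelling coordinates and extending by zero, on both `ℓ₁` and `c₀`. The
contraction on `ℓ₁` is adjoint, for the canonical pairing, to the contraction on `c₀` given by the
inverse partial bijection. By the metric mapping property, tensor products of these contractions are
contractions for `α` and `α'`.

Isometry: an algebraic tensor over the `ℓ₁(J i)` lives on countable subsets of the `J i`. It can be
moved to `ℕ` and back without changing its norm or its pairings, so the isometry over `ℕ` applies
(`HasSRN.norm_sequencePairing_le`, `HasSRN.norm_ofTensor_le`).

Surjectivity: let `ψ` be a functional on the tensor product of the `c₀(J i)`. If infinitely many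
coefficients of `ψ` on tensors of unit vectors had modulus at least `δ > 0`, a sequence of them
could be carried to `ℕ`. This would give a functional over `ℕ` whose coefficients do not tend to
zero, yet sRN represents it by an element of the completed tensor product of `ℓ₁`, whose
coefficients do tend to zero. Hence only countably many coefficients are nonzero
(`HasSRN.finite_large_coefficients`, `HasSRN.countable_coefficients`). So `ψ` is determined on
countable index sets, is represented there by sRN, and the representing element is carried back to
the `J i`. -/

noncomputable section

open Filter Topology

/-! ### Transport of functions along partial bijections -/

namespace PEquiv

/-- The push-forward of a function along a partial equivalence, extended by zero. -/
def push {J K M : Type*} [Zero M] (f : J ≃. K) (a : J → M) (k : K) : M :=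
  (f.symm k).elim 0 a

section Push

variable {J K M : Type*}

theorem push_apply_of_mem [Zero M] (f : J ≃. K) (a : J → M) {j : J} {k : K} (h : k ∈ f j) :
    f.push a k = a j := by
  have : f.symm k = some j := f.eq_some_iff.2 h
  simp [push, this]

theorem push_apply_of_forall_notMem [Zero M] (f : J ≃. K) (a : J → M) {k : K}
    (h : ∀ j, k ∉ f j) : f.push a k = 0 := by
  have : f.symm k = none := by
    rw [Option.eq_none_iff_forall_not_mem]
    exact fun j hj => h j (f.mem_iff_mem.1 hj)
  simp [push, this]

/-- The alternative depends on `k` alone and not on the function, so one case split serves several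
functions at once. -/
theorem push_cases [Zero M] (f : J ≃. K) (k : K) :
    (∃ j, k ∈ f j ∧ ∀ a : J → M, f.push a k = a j) ∨
      (∀ j, k ∉ f j) ∧ ∀ a : J → M, f.push a k = 0 := by
  by_cases h : ∃ j, k ∈ f j
  · obtain ⟨j, hj⟩ := h
    exact Or.inl ⟨j, hj, fun a => f.push_apply_of_mem a hj⟩
  · push Not at h
    exact Or.inr ⟨h, fun a => f.push_apply_of_forall_notMem a h⟩

theorem push_symm_push [Zero M] (f : J ≃. K) (a : J → M) (h : ∀ j, a j ≠ 0 → (f j).isSome) :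
    f.symm.push (f.push a) = a := by
  funext j
  rcases f.symm.push_cases (M := M) j with ⟨k, hk, h1⟩ | ⟨hk, h1⟩
  · rw [h1, f.push_apply_of_mem a (f.mem_iff_mem.1 hk)]
  · rw [h1]
    by_contra h0
    obtain ⟨k, hk'⟩ := Option.isSome_iff_exists.1 (h j (Ne.symm h0))
    exact hk k (f.mem_iff_mem.2 hk')

/-- Both families have the same nonzero terms, indexed by the pairs matched by `f`, so no
summability is assumed. This is the source of the adjointness of the transports on `ℓ₁` and `c₀`. -/
theorem hasSum_push_mul [NonUnitalNonAssocSemiring M] [TopologicalSpace M] (f : J ≃. K)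
    (a : J → M) (b : K → M) (s : M) :
    HasSum (fun k => f.push a k * b k) s ↔ HasSum (fun j => a j * f.symm.push b j) s := by
  have hS : ∀ j : Function.support (fun j => a j * f.symm.push b j), (f j).isSome := by
    intro j
    rcases f.symm.push_cases (M := M) j with ⟨k, hk, h1⟩ | ⟨hk, h1⟩
    · exact Option.isSome_iff_exists.2 ⟨k, f.mem_iff_mem.1 hk⟩
    · exact absurd (by simp [h1]) j.2
  refine hasSum_iff_hasSum_of_ne_zero_bij (fun j => (f j).get (hS j)) ?_ ?_ ?_
  · intro j j' h
    have hj' := Option.get_mem (hS j')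
    rw [← show (f j).get (hS j) = (f j').get (hS j') from h] at hj'
    exact Subtype.ext (f.inj (Option.get_mem (hS j)) hj')
  · intro k hk
    rcases f.push_cases (M := M) k with ⟨j, hj, h1⟩ | ⟨hj, h1⟩
    · refine ⟨⟨j, ?_⟩, Option.get_of_mem _ hj⟩
      rw [Function.mem_support, h1] at hk
      rwa [Function.mem_support, f.symm.push_apply_of_mem b (f.mem_iff_mem.2 hj)]
    · exact absurd (by simp [h1]) hk
  · intro j
    have hj := Option.get_mem (hS j)
    rw [f.push_apply_of_mem a hj, f.symm.push_apply_of_mem b (f.mem_iff_mem.2 hj)]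

end Push

/-- A partial equivalence with a given countable domain, with values in `ℕ`. -/
theorem exists_of_countable {J : Type u} {A : Set J} (hA : A.Countable) :
    ∃ f : J ≃. ULift.{u} ℕ, ∀ j, (f j).isSome ↔ j ∈ A := by
  classical
  obtain ⟨e, he⟩ := Set.countable_iff_exists_injOn.1 hA
  refine ⟨⟨fun j => if j ∈ A then some ⟨e j⟩ else none,
    fun k => if h : ∃ j ∈ A, e j = k.down then some h.choose else none, ?_⟩, fun j => ?_⟩
  · intro j k
    constructor
    · intro h
      split_ifs at h with h1
      · obtain rfl : h1.choose = j := by simpa using h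
        simp [h1.choose_spec.1, h1.choose_spec.2]
    · intro h
      split_ifs at h with h1
      · obtain rfl : (⟨e j⟩ : ULift ℕ) = k := by simpa using h
        have h2 : ∃ j' ∈ A, e j' = e j := ⟨j, h1, rfl⟩
        rw [dif_pos h2]
        exact congrArg some (he h2.choose_spec.1 h1 h2.choose_spec.2)
  · simp only [PEquiv.coe_mk_apply]
    split_ifs with h <;> simp [h]

end PEquiv

/-! ### The space `ℓ₁(J)` and its transports -/

section EllOne

variable {𝕜 : Type} [RCLike 𝕜] {J K : Type u}

theorem EllOne.summable_norm (a : EllOne 𝕜 J) : Summable fun j => ‖a j‖ := by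
  simpa using (lp.memℓp a).summable (by simp)

theorem EllOne.norm_eq_tsum (a : EllOne 𝕜 J) : ‖a‖ = ∑' j, ‖a j‖ := by
  simpa using lp.norm_eq_tsum_rpow (by simp) a

theorem EllOne.memℓp {a : J → 𝕜} (h : Summable fun j => ‖a j‖) : Memℓp a 1 :=
  memℓp_gen (by simpa using h)

theorem PEquiv.norm_push (f : J ≃. K) (a : J → 𝕜) (k : K) :
    ‖f.push a k‖ = f.push (fun j => ‖a j‖) k := by
  rcases f.push_cases (M := 𝕜) k with ⟨j, hj, h1⟩ | ⟨hj, h1⟩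
  · rw [h1, f.push_apply_of_mem _ hj]
  · rw [h1, f.push_apply_of_forall_notMem _ hj, norm_zero]

theorem PEquiv.push_one_mem (f : J ≃. K) (k : K) :
    0 ≤ f.push (fun _ => (1 : ℝ)) k ∧ f.push (fun _ => (1 : ℝ)) k ≤ 1 := by
  rcases f.push_cases (M := ℝ) k with ⟨j, hj, h1⟩ | ⟨hj, h1⟩ <;> simp [h1]

theorem PEquiv.hasSum_norm_push (f : J ≃. K) (a : EllOne 𝕜 J) :
    ∃ s ≤ ‖a‖, HasSum (fun k => ‖f.push a k‖) s := by
  -- The push-forward of the constant `1` along `f.symm` is the indicator of the domain of `f`: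
  -- transport keeps exactly these terms of the norm and drops the others.
  have h1 : Summable fun j => ‖a j‖ * f.symm.push (fun _ => (1 : ℝ)) j :=
    a.summable_norm.of_nonneg_of_le
      (fun j => mul_nonneg (norm_nonneg _) (f.symm.push_one_mem j).1)
      (fun j => mul_le_of_le_one_right (norm_nonneg _) (f.symm.push_one_mem j).2)
  refine ⟨∑' j, ‖a j‖ * f.symm.push (fun _ => (1 : ℝ)) j, ?_, ?_⟩
  rotate_left
  · simp only [PEquiv.norm_push]
    simpa using (f.hasSum_push_mul (fun j => ‖a j‖) (fun _ => 1) _).2 h1.hasSum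
  · rw [EllOne.norm_eq_tsum]
    exact h1.tsum_le_tsum
      (fun j => mul_le_of_le_one_right (norm_nonneg _) (f.symm.push_one_mem j).2) a.summable_norm

theorem PEquiv.push_add {M : Type*} [AddZeroClass M] (f : J ≃. K) (a b : J → M) :
    f.push (a + b) = f.push a + f.push b := by
  funext k
  rcases f.push_cases (M := M) k with ⟨j, hj, h1⟩ | ⟨hj, h1⟩ <;> simp [h1]

theorem PEquiv.push_smul (f : J ≃. K) (r : 𝕜) (a : J → 𝕜) :
    f.push (r • a) = r • f.push a := by
  funext k
  rcases f.push_cases (M := 𝕜) k with ⟨j, hj, h1⟩ | ⟨hj, h1⟩ <;> simp [h1]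

/-- The contraction `ℓ₁(J) → ℓ₁(K)` induced by a partial equivalence of the index sets. -/
def PEquiv.ellOne (f : J ≃. K) : EllOne 𝕜 J →L[𝕜] EllOne 𝕜 K :=
  LinearMap.mkContinuous
    { toFun := fun a => ⟨f.push a, EllOne.memℓp (f.hasSum_norm_push a).choose_spec.2.summable⟩
      map_add' := fun a b => lp.ext (f.push_add a b)
      map_smul' := fun r a => lp.ext (f.push_smul r a) } 1 fun a => by
    obtain ⟨s, hs, h⟩ := f.hasSum_norm_push a
    rw [EllOne.norm_eq_tsum, one_mul]
    exact h.tsum_eq.trans_le hs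

theorem PEquiv.norm_ellOne_le (f : J ≃. K) : ‖(f.ellOne : EllOne 𝕜 J →L[𝕜] _)‖ ≤ 1 :=
  LinearMap.mkContinuous_norm_le _ zero_le_one _

end EllOne

/-! ### The space `c₀(J)` and its unit vectors -/

namespace CZero

variable {𝕜 : Type} [RCLike 𝕜] {J K : Type u}

theorem ext {x y : CZero 𝕜 J} (h : ∀ j, x j = y j) : x = y :=
  @ZeroAtInftyContinuousMap.ext J 𝕜 ⊥ _ _ x y h

theorem add_apply (x y : CZero 𝕜 J) (j : J) : (x + y) j = x j + y j := rfl

theorem sub_apply (x y : CZero 𝕜 J) (j : J) : (x - y) j = x j - y j := rfl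

theorem smul_apply (r : 𝕜) (x : CZero 𝕜 J) (j : J) : (r • x) j = r * x j := rfl

theorem norm_le_iff {x : CZero 𝕜 J} {C : ℝ} (hC : 0 ≤ C) : ‖x‖ ≤ C ↔ ∀ j, ‖x j‖ ≤ C :=
  let _ : TopologicalSpace J := ⊥
  BoundedContinuousFunction.norm_le (f := ZeroAtInftyContinuousMap.toBCF x) hC

theorem norm_apply_le (x : CZero 𝕜 J) (j : J) : ‖x j‖ ≤ ‖x‖ :=
  (norm_le_iff (norm_nonneg x)).1 le_rfl j

theorem tendsto_cofinite (x : CZero 𝕜 J) : Tendsto x cofinite (𝓝 0) := by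
  let _ : TopologicalSpace J := ⊥
  have : DiscreteTopology J := ⟨rfl⟩
  rw [← cocompact_eq_cofinite]
  exact x.zero_at_infty'

/-- The element of `c₀(J)` given by a family tending to zero. -/
def mk (x : J → 𝕜) (h : Tendsto x cofinite (𝓝 0)) : CZero 𝕜 J :=
  letI : TopologicalSpace J := ⊥
  haveI : DiscreteTopology J := ⟨rfl⟩
  { toFun := x
    continuous_toFun := continuous_of_discreteTopology
    zero_at_infty' := by rwa [cocompact_eq_cofinite] }

@[simp]
theorem coe_mk (x : J → 𝕜) (h : Tendsto x cofinite (𝓝 0)) : ⇑(mk x h) = x := rfl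

/-- The indices where the push-forward is large are images under `f` of the finitely many indices
where `x` is large, and each index has at most one image. -/
theorem tendsto_push (f : J ≃. K) (x : CZero 𝕜 J) : Tendsto (f.push x) cofinite (𝓝 0) := by
  rw [Metric.tendsto_nhds]
  intro δ hδ
  have h1 := Metric.tendsto_nhds.1 x.tendsto_cofinite δ hδ
  rw [eventually_cofinite] at h1 ⊢
  refine (h1.biUnion (t := fun j => {k | k ∈ f j}) fun j _ => ?_).subset fun k hk => ?_
  · refine Set.Subsingleton.finite fun k hk l hl => Option.mem_unique hk hl
  · rcases f.push_cases (M := 𝕜) k with ⟨j, hj, h2⟩ | ⟨hj, h2⟩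
    · rw [Set.mem_ofPred_eq, h2] at hk
      exact Set.mem_biUnion hk hj
    · exact absurd (by simpa [h2] using hδ) hk

/-- The unit vectors of `c₀(J)`. -/
def single (j : J) : CZero 𝕜 J :=
  letI := Classical.decEq J
  mk (Pi.single j 1) <| by
    refine tendsto_nhds_of_eventually_eq ?_
    rw [eventually_cofinite]
    refine (Set.finite_singleton j).subset fun k hk => ?_
    by_contra h
    exact hk (Pi.single_eq_of_ne h _)

theorem single_self (j : J) : (single j : CZero 𝕜 J) j = 1 := by
  simp [single]

theorem single_of_ne {j k : J} (h : k ≠ j) : (single j : CZero 𝕜 J) k = 0 := by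
  simp [single, h]

theorem norm_single_le (j : J) : ‖(single j : CZero 𝕜 J)‖ ≤ 1 := by
  rw [norm_le_iff zero_le_one]
  intro k
  by_cases h : k = j
  · simp [h, single_self]
  · simp [single_of_ne h]

theorem dense_span_single : Dense 
    (Submodule.span 𝕜 (Set.range (single : J → CZero 𝕜 J)) : Set (CZero 𝕜 J)) := by
  classical
  intro x
  rw [Metric.mem_closure_iff]
  intro δ hδ
  have h1 := Metric.tendsto_nhds.1 x.tendsto_cofinite (δ / 2) (half_pos hδ)
  rw [eventually_cofinite] at h1
  -- The approximant truncates `x` to the finite set where its modulus is at least `δ / 2`.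
  refine ⟨∑ j ∈ h1.toFinset, x j • single j, Submodule.sum_mem _ fun j _ =>
    Submodule.smul_mem _ _ (Submodule.subset_span ⟨j, rfl⟩), ?_⟩
  have h2 : ∀ (s : Finset J) (k : J), (∑ j ∈ s, x j • (single j : CZero 𝕜 J)) k =
      if k ∈ s then x k else 0 := by
    intro s k
    induction s using Finset.induction_on with
    | empty => rfl
    | insert j s hj ih =>
      rw [Finset.sum_insert hj, add_apply, ih, smul_apply]
      by_cases h : k = j
      · subst h
        simp [hj, single_self]
      · simp [h, single_of_ne h]
  refine lt_of_le_of_lt ?_ (half_lt_self hδ)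
  rw [dist_eq_norm, norm_le_iff (half_pos hδ).le]
  intro k
  rw [sub_apply, h2]
  split_ifs with h
  · simpa using (half_pos hδ).le
  · simpa using (show dist (x k) 0 < δ / 2 by simpa using h).le

end CZero

/-! ### Transport on `c₀(J)` and the duality with `ℓ₁(J)` -/

section

variable {𝕜 : Type} [RCLike 𝕜] {J K : Type u}

/-- The contraction `c₀(J) → c₀(K)` induced by a partial equivalence of the index sets. -/
def PEquiv.cZero (f : J ≃. K) : CZero 𝕜 J →L[𝕜] CZero 𝕜 K :=
  LinearMap.mkContinuous
    { toFun := fun x => CZero.mk (f.push x) (CZero.tendsto_push f x)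
      map_add' := fun x y => CZero.ext fun k => congrFun (f.push_add x y) k
      map_smul' := fun r x => CZero.ext fun k => congrFun (f.push_smul r x) k } 1 fun x => by
    rw [one_mul, CZero.norm_le_iff (norm_nonneg x)]
    intro k
    change ‖f.push x k‖ ≤ ‖x‖
    rcases f.push_cases (M := 𝕜) k with ⟨j, hj, h2⟩ | ⟨hj, h2⟩
    · rw [h2]
      exact x.norm_apply_le j
    · simp [h2]

@[simp]
theorem PEquiv.coe_cZero (f : J ≃. K) (x : CZero 𝕜 J) : ⇑(f.cZero x) = f.push x := rfl

theorem PEquiv.norm_cZero_le (f : J ≃. K) : ‖(f.cZero : CZero 𝕜 J →L[𝕜] _)‖ ≤ 1 :=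
  LinearMap.mkContinuous_norm_le _ zero_le_one _

theorem PEquiv.cZero_single_of_mem (f : J ≃. K) {j : J} {k : K} (h : k ∈ f j) :
    f.cZero (CZero.single j : CZero 𝕜 J) = CZero.single k := by
  refine CZero.ext fun l => ?_
  rw [f.coe_cZero]
  rcases f.push_cases (M := 𝕜) l with ⟨i, hi, h2⟩ | ⟨hi, h2⟩
  · rw [h2]
    by_cases hij : i = j
    · subst hij
      obtain rfl := Option.mem_unique h hi
      simp [CZero.single_self]
    · rw [CZero.single_of_ne hij, CZero.single_of_ne]
      rintro rfl
      exact hij (f.inj hi h)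
  · rw [h2, CZero.single_of_ne]
    rintro rfl
    exact hi j h

theorem PEquiv.cZero_single_of_eq_none (f : J ≃. K) {j : J} (h : f j = none) :
    f.cZero (CZero.single j : CZero 𝕜 J) = 0 := by
  refine CZero.ext fun l => ?_
  rw [f.coe_cZero]
  change _ = (0 : 𝕜)
  rcases f.push_cases (M := 𝕜) l with ⟨i, hi, h2⟩ | ⟨hi, h2⟩
  · rw [h2, CZero.single_of_ne]
    rintro rfl
    simp [h] at hi
  · rw [h2]

theorem EllOne.summable_mul (a : EllOne 𝕜 J) (x : CZero 𝕜 J) : Summable fun j => a j * x j := by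
  refine Summable.of_norm_bounded (a.summable_norm.mul_right ‖x‖) fun j => ?_
  rw [norm_mul]
  exact mul_le_mul_of_nonneg_left (x.norm_apply_le j) (norm_nonneg _)

/-- The canonical pairing of `ℓ₁(J)` and `c₀(J)`. -/
def ellOnePairing : EllOne 𝕜 J →ₗ[𝕜] Module.Dual 𝕜 (CZero 𝕜 J) :=
  LinearMap.mk₂ 𝕜 (fun a x => ∑' j, a j * x j)
    (fun a b x => by
      rw [← (a.summable_mul x).tsum_add (b.summable_mul x)]
      exact tsum_congr fun j => add_mul (a j) (b j) (x j))
    (fun r a x => by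
      rw [smul_eq_mul, ← tsum_mul_left]
      exact tsum_congr fun j => mul_assoc r (a j) (x j))
    (fun a x y => by
      rw [← (a.summable_mul x).tsum_add (a.summable_mul y)]
      exact tsum_congr fun j => mul_add (a j) (x j) (y j))
    (fun r a x => by
      rw [smul_eq_mul, ← tsum_mul_left]
      exact tsum_congr fun j => mul_left_comm (a j) r (x j))

theorem ellOnePairing_apply (a : EllOne 𝕜 J) (x : CZero 𝕜 J) :
    ellOnePairing a x = ∑' j, a j * x j := rfl

/-- This adjointness lets pairings over one family of index sets be computed over another. -/
theorem PEquiv.ellOnePairing_ellOne (f : J ≃. K) (a : EllOne 𝕜 J) (x : CZero 𝕜 K) :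
    ellOnePairing (f.ellOne a) x = ellOnePairing a (f.symm.cZero x) := by
  have h := (a.summable_mul (f.symm.cZero x)).hasSum
  exact ((f.hasSum_push_mul a x _).2 h).tsum_eq

theorem ellOnePairing_single (a : EllOne 𝕜 J) (j : J) :
    ellOnePairing a (CZero.single j) = a j := by
  rw [ellOnePairing_apply, tsum_eq_single j fun k hk => by rw [CZero.single_of_ne hk, mul_zero],
    CZero.single_self, mul_one]

theorem EllOne.countable_support (a : EllOne 𝕜 J) : {j | a j ≠ 0}.Countable := by
  simpa [Function.support] using a.summable_norm.countable_support

theorem EllOne.tendsto_cofinite (a : EllOne 𝕜 J) : Tendsto a cofinite (𝓝 0) :=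
  tendsto_zero_iff_norm_tendsto_zero.2 a.summable_norm.tendsto_cofinite_zero

end

/-! ### Completions and their duals -/

section Completion

variable {𝕜 X Y : Type*} [RCLike 𝕜] [NormedAddCommGroup X] [NormedSpace 𝕜 X]
  [NormedAddCommGroup Y] [NormedSpace 𝕜 Y]

theorem ContinuousLinearMap.opNorm_comp_toComplL
    (g : UniformSpace.Completion X →L[𝕜] Y) :
    ‖g.comp (UniformSpace.Completion.toComplL (𝕜 := 𝕜) (E := X))‖ = ‖g‖ := by
  refine le_antisymm (opNorm_le_bound _ (norm_nonneg _) fun x => ?_)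
    (opNorm_le_bound _ (norm_nonneg _) fun x => ?_)
  · simpa using g.le_opNorm (x : UniformSpace.Completion X)
  · induction x using UniformSpace.Completion.induction_on with
    | hp => exact isClosed_le (by fun_prop) (by fun_prop)
    | ih x =>
      simpa using
        (g.comp (UniformSpace.Completion.toComplL (𝕜 := 𝕜) (E := X))).le_opNorm x

variable [CompleteSpace Y]

/-- The extension of a continuous linear map to the completion. -/
def ContinuousLinearMap.extendCompletion (g : X →L[𝕜] Y) :
    UniformSpace.Completion X →L[𝕜] Y :=
  g.extend (UniformSpace.Completion.toComplL (𝕜 := 𝕜) (E := X))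

@[simp]
theorem ContinuousLinearMap.extendCompletion_coe (g : X →L[𝕜] Y) (x : X) :
    g.extendCompletion (x : UniformSpace.Completion X) = g x :=
  g.extend_eq (e := UniformSpace.Completion.toComplL (𝕜 := 𝕜) (E := X))
    UniformSpace.Completion.denseRange_coe
    (UniformSpace.Completion.isUniformInducing_coe X) x

variable (𝕜 X) in
/-- A normed space and its completion have the same dual. -/
def dualCompletionEquiv :
    StrongDual 𝕜 (UniformSpace.Completion X) ≃ₗᵢ[𝕜] StrongDual 𝕜 X :=
  LinearIsometryEquiv.ofSurjective
    { toFun := fun g => g.comp (UniformSpace.Completion.toComplL (𝕜 := 𝕜) (E := X))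
      map_add' := fun _ _ => rfl
      map_smul' := fun _ _ => rfl
      norm_map' := ContinuousLinearMap.opNorm_comp_toComplL }
    fun g => ⟨g.extendCompletion, by ext x; exact g.extendCompletion_coe x⟩

@[simp]
theorem dualCompletionEquiv_apply (g : StrongDual 𝕜 (UniformSpace.Completion X)) (x : X) :
    dualCompletionEquiv 𝕜 X g x = g (x : UniformSpace.Completion X) := rfl

@[simp]
theorem dualCompletionEquiv_symm_apply_coe (g : StrongDual 𝕜 X) (x : X) :
    (dualCompletionEquiv 𝕜 X).symm g (x : UniformSpace.Completion X) = g x := by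
  rw [← dualCompletionEquiv_apply, LinearIsometryEquiv.apply_symm_apply]

end Completion

/-! ### Operators and functionals on `α`-normed tensor products -/

namespace FullTensorNorm

section Space

variable {𝕜 : Type} [RCLike 𝕜] {n : ℕ} (α : FullTensorNorm.{u} 𝕜 n) {E F : Fin n → Type u}
  [∀ i, NormedAddCommGroup (E i)] [∀ i, NormedSpace 𝕜 (E i)] [∀ i, CompleteSpace (E i)]
  [∀ i, NormedAddCommGroup (F i)] [∀ i, NormedSpace 𝕜 (F i)] [∀ i, CompleteSpace (F i)]

variable (E) in
/-- The identity from the algebraic tensor product to its copy normed by `α`. -/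
def ofTensor : (⨂[𝕜] i, E i) ≃ₗ[𝕜] α.Space E := LinearEquiv.refl 𝕜 _

theorem elementary_eq (x : ∀ i, E i) :
    α.elementary x = (α.ofTensor E (⨂ₜ[𝕜] i, x i) : UniformSpace.Completion (α.Space E)) := rfl

theorem norm_ofTensor_tprod_le (x : ∀ i, E i) : ‖α.ofTensor E (⨂ₜ[𝕜] i, x i)‖ ≤ ∏ i, ‖x i‖ :=
  (α.le_projective E _).trans (PiTensorProduct.projectiveSeminorm_tprod_le x)

/-- The tensor product of contractions, as an operator between tensor products normed by `α`. -/
def mapL (T : ∀ i, E i →L[𝕜] F i) : α.Space E →L[𝕜] α.Space F :=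
  LinearMap.mkContinuous
    ((α.ofTensor F).toLinearMap ∘ₗ PiTensorProduct.map (fun i => (T i).toLinearMap) ∘ₗ
      (α.ofTensor E).symm.toLinearMap) (∏ i, ‖T i‖) (α.map_le E F T)

theorem mapL_ofTensor (T : ∀ i, E i →L[𝕜] F i) (z : ⨂[𝕜] i, E i) :
    α.mapL T (α.ofTensor E z) =
      α.ofTensor F (PiTensorProduct.map (fun i => (T i).toLinearMap) z) := rfl

theorem mapL_ofTensor_tprod (T : ∀ i, E i →L[𝕜] F i) (x : ∀ i, E i) :
    α.mapL T (α.ofTensor E (⨂ₜ[𝕜] i, x i)) = α.ofTensor F (⨂ₜ[𝕜] i, T i (x i)) := by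
  rw [mapL_ofTensor, PiTensorProduct.map_tprod]
  rfl

theorem norm_mapL_apply_le {T : ∀ i, E i →L[𝕜] F i} (hT : ∀ i, ‖T i‖ ≤ 1) (z : α.Space E) :
    ‖α.mapL T z‖ ≤ ‖z‖ :=
  (α.map_le E F T z).trans (mul_le_of_le_one_left (norm_nonneg z)
    (Finset.prod_le_one (fun _ _ => norm_nonneg _) fun i _ => hT i))

theorem norm_apply_tprod_le (ψ : StrongDual 𝕜 (α.Space E)) (x : ∀ i, E i) :
    ‖ψ (α.ofTensor E (⨂ₜ[𝕜] i, x i))‖ ≤ ‖ψ‖ * ∏ i, ‖x i‖ :=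
  (ψ.le_opNorm _).trans (mul_le_mul_of_nonneg_left (α.norm_ofTensor_tprod_le x) (norm_nonneg ψ))

/-- Functionals on a tensor product agree if they agree on tensors of vectors taken from sets with
dense span. -/
theorem dual_ext_of_dense {ι : Fin n → Type*} (b : ∀ i, ι i → E i)
    (hb : ∀ i, Dense (Submodule.span 𝕜 (Set.range (b i)) : Set (E i)))
    {φ ψ : StrongDual 𝕜 (α.Space E)}
    (h : ∀ j : ∀ i, ι i, φ (α.ofTensor E (⨂ₜ[𝕜] i, b i (j i))) =
      ψ (α.ofTensor E (⨂ₜ[𝕜] i, b i (j i)))) : φ = ψ := by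
  classical
  -- The coordinates in `s` are free and the others lie in the given sets; the induction frees one
  -- coordinate at a time.
  have key : ∀ (s : Finset (Fin n)) (x : ∀ i, E i), (∀ i ∉ s, x i ∈ Set.range (b i)) →
      φ (α.ofTensor E (⨂ₜ[𝕜] i, x i)) = ψ (α.ofTensor E (⨂ₜ[𝕜] i, x i)) := by
    intro s
    induction s using Finset.induction_on with
    | empty =>
      intro x hx
      choose j hj using fun i => hx i (Finset.notMem_empty i)
      obtain rfl : (fun i => b i (j i)) = x := funext hj
      exact h j
    | insert i s hi ih =>
      intro x hx
      let D : E i →ₗ[𝕜] 𝕜 := (φ - ψ).toLinearMap ∘ₗ (α.ofTensor E).toLinearMap ∘ₗ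
        (PiTensorProduct.tprod 𝕜).toLinearMap x i
      have hD : ∀ y, D y = (φ - ψ) (α.ofTensor E (⨂ₜ[𝕜] k, Function.update x i y k)) :=
        fun y => rfl
      -- Since `α ≤ π`, the difference of the functionals is bounded in the `i`-th variable by its
      -- norm times the norms of the other factors. Being continuous, it vanishes once it vanishes
      -- on a set with dense span.
      let D' : E i →L[𝕜] 𝕜 := D.mkContinuous
        (‖φ - ψ‖ * ∏ k ∈ Finset.univ.erase i, ‖x k‖) fun y => by
          rw [hD]
          refine (α.norm_apply_tprod_le _ _).trans_eq ?_
          rw [← Finset.mul_prod_erase _ _ (Finset.mem_univ i), Function.update_self,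
            mul_assoc, mul_comm ‖y‖]
          congr 2
          refine Finset.prod_congr rfl fun k hk => ?_
          rw [Function.update_of_ne (Finset.ne_of_mem_erase hk)]
      have h0 : D' = 0 := by
        refine ContinuousLinearMap.ext_on (hb i) ?_
        rintro _ ⟨j, rfl⟩
        change D (b i j) = 0
        rw [hD, sub_apply, sub_eq_zero]
        refine ih _ fun k hk => ?_
        by_cases hki : k = i
        · subst hki
          simp
        · rw [Function.update_of_ne hki]
          exact hx k (by simp [hki, hk])
      have h1 : D (x i) = 0 := congrArg (fun g : E i →L[𝕜] 𝕜 => g (x i)) h0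
      rwa [hD, Function.update_eq_self, sub_apply, sub_eq_zero] at h1
  ext z
  obtain ⟨z, rfl⟩ := (α.ofTensor E).surjective z
  induction z using PiTensorProduct.induction_on with
  | smul_tprod r x =>
    rw [map_smul, map_smul, map_smul, key Finset.univ x fun i hi => absurd (Finset.mem_univ i) hi]
  | add x y hx hy => rw [map_add, map_add, map_add, hx, hy]

end Space

/-! ### The canonical pairing on algebraic tensors -/

section Pairing

variable {𝕜 : Type} [RCLike 𝕜] {n : ℕ} {J K : Fin n → Type u}

/-- The canonical pairing of `⨂ ℓ₁(J i)` and `⨂ c₀(J i)`. -/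
def sequencePairing (J : Fin n → Type u) :
    (⨂[𝕜] i, EllOne 𝕜 (J i)) →ₗ[𝕜] Module.Dual 𝕜 (⨂[𝕜] i, CZero 𝕜 (J i)) :=
  PiTensorProduct.dualDistrib ∘ₗ PiTensorProduct.map (fun _ => ellOnePairing)

@[simp]
theorem sequencePairing_tprod (a : ∀ i, EllOne 𝕜 (J i)) (x : ∀ i, CZero 𝕜 (J i)) :
    sequencePairing J (⨂ₜ[𝕜] i, a i) (⨂ₜ[𝕜] i, x i) = ∏ i, ellOnePairing (a i) (x i) := by
  simp [sequencePairing]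

theorem sequencePairing_map (f : ∀ i, J i ≃. K i) (w : ⨂[𝕜] i, EllOne 𝕜 (J i))
    (x : ⨂[𝕜] i, CZero 𝕜 (K i)) :
    sequencePairing K (PiTensorProduct.map (fun i => (f i).ellOne.toLinearMap) w) x =
      sequencePairing J w (PiTensorProduct.map (fun i => (f i).symm.cZero.toLinearMap) x) := by
  induction w using PiTensorProduct.induction_on with
  | smul_tprod s a =>
    induction x using PiTensorProduct.induction_on with
    | smul_tprod r x => simp [PEquiv.ellOnePairing_ellOne]
    | add x y hx hy => simp only [map_add, hx, hy]
  | add x y hx hy => simp only [map_add, LinearMap.add_apply, hx, hy]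

/-- A tensor is a finite sum of elementary ones, and each `ℓ₁` factor has countable support; the
unions of these supports serve as `A i`. Countable support is expressed through round trips, the
form in which it is used. -/
theorem exists_countable_support (w : ⨂[𝕜] i, EllOne 𝕜 (J i)) :
    ∃ A : ∀ i, Set (J i), (∀ i, (A i).Countable) ∧
      ∀ {K : Fin n → Type u} (f : ∀ i, J i ≃. K i), (∀ i, ∀ j ∈ A i, (f i j).isSome) →
        PiTensorProduct.map (fun i => (f i).symm.ellOne.toLinearMap)
          (PiTensorProduct.map (fun i => (f i).ellOne.toLinearMap) w) = w := by
  induction w using PiTensorProduct.induction_on with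
  | smul_tprod s a =>
    refine ⟨fun i => {j | a i j ≠ 0}, fun i => (a i).countable_support, fun f hf => ?_⟩
    simp only [map_smul, PiTensorProduct.map_tprod]
    congr 2
    exact funext fun i => lp.ext ((f i).push_symm_push (a i) (hf i))
  | add x y hx hy =>
    obtain ⟨A, hA, hA'⟩ := hx
    obtain ⟨B, hB, hB'⟩ := hy
    refine ⟨fun i => A i ∪ B i, fun i => (hA i).union (hB i), fun f hf => ?_⟩
    rw [map_add, map_add, hA' f fun i j hj => hf i j (Or.inl hj),
      hB' f fun i j hj => hf i j (Or.inr hj)]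

theorem exists_pequiv_nat (A : ∀ i, Set (J i)) (hA : ∀ i, (A i).Countable) :
    ∃ f : ∀ i, J i ≃. ULift.{u} ℕ, ∀ i j, (f i j).isSome ↔ j ∈ A i := by
  choose f hf using fun i => PEquiv.exists_of_countable (hA i)
  exact ⟨f, hf⟩

theorem tendsto_sequencePairing_single (w : ⨂[𝕜] i, EllOne 𝕜 (J i)) :
    Tendsto (fun j : ∀ i, J i => sequencePairing J w (⨂ₜ[𝕜] i, CZero.single (j i)))
      cofinite (𝓝 0) := by
  induction w using PiTensorProduct.induction_on with
  | smul_tprod r a =>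
    simp only [map_smul, LinearMap.smul_apply, sequencePairing_tprod, ellOnePairing_single]
    rw [← smul_zero r]
    refine Tendsto.const_smul ?_ r
    -- A multi-index leaves all finite sets when some coordinate does. It thus suffices to let the
    -- `i`-th coordinate escape: that factor tends to zero while the others stay bounded by the
    -- norms of the `a k`.
    rw [← Filter.coprodᵢ_cofinite, Filter.coprodᵢ, tendsto_iSup]
    intro i
    rw [tendsto_zero_iff_norm_tendsto_zero]
    have h1 : Tendsto (fun j : ∀ i, J i => ‖a i (j i)‖ * ∏ k ∈ Finset.univ.erase i, ‖a k‖)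
        (comap (Function.eval i) cofinite) (𝓝 0) := by
      rw [← zero_mul (∏ k ∈ Finset.univ.erase i, ‖a k‖)]
      exact ((tendsto_zero_iff_norm_tendsto_zero.1 (a i).tendsto_cofinite).comp
        tendsto_comap).mul_const _
    refine squeeze_zero (fun _ => norm_nonneg _) (fun j => ?_) h1
    rw [norm_prod, ← Finset.mul_prod_erase _ _ (Finset.mem_univ i)]
    refine mul_le_mul_of_nonneg_left ?_ (norm_nonneg _)
    exact Finset.prod_le_prod (fun _ _ => norm_nonneg _) fun k _ =>
      lp.norm_apply_le_norm one_ne_zero (a k) (j k)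
  | add x y hx hy =>
    simpa only [map_add, LinearMap.add_apply, add_zero] using hx.add hy

end Pairing

end FullTensorNorm

/-! ### The isometric embedding over arbitrary index sets -/

namespace FullTensorNorm

variable {𝕜 : Type} [RCLike 𝕜] {n : ℕ} {α : FullTensorNorm.{u} 𝕜 n}

/-- A space and its completion have the same dual, so functionals may be tested on algebraic
tensors. The formula on elementary tensors extends by linearity in both arguments. -/
theorem HasSRN.exists_equiv (h : α.HasSRN) :
    ∃ Φ : α.Completed (fun _ => EllOne 𝕜 (ULift.{u} ℕ)) ≃ₗᵢ[𝕜]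
        StrongDual 𝕜 (α.dual.Space (fun _ => CZero 𝕜 (ULift.{u} ℕ))),
      ∀ w x, Φ (α.ofTensor _ w : UniformSpace.Completion _) (α.dual.ofTensor _ x) =
        sequencePairing (fun _ => ULift.{u} ℕ) w x := by
  obtain ⟨Φ, hΦ⟩ := h
  refine ⟨Φ.trans (dualCompletionEquiv 𝕜 _), fun w x => ?_⟩
  rw [LinearIsometryEquiv.trans_apply, dualCompletionEquiv_apply]
  induction w using PiTensorProduct.induction_on with
  | smul_tprod s a =>
    induction x using PiTensorProduct.induction_on with
    | smul_tprod r x =>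
      have h1 := hΦ a x
      rw [elementary_eq, elementary_eq] at h1
      simp only [map_smul, UniformSpace.Completion.coe_smul, LinearMap.smul_apply,
        sequencePairing_tprod, smul_apply, h1]
      rfl
    | add x y hx hy => simp only [map_add, UniformSpace.Completion.coe_add, hx, hy]
  | add x y hx hy =>
    simp only [map_add, UniformSpace.Completion.coe_add, LinearMap.add_apply, add_apply, hx, hy]

variable {J : Fin n → Type u}

/-- Reduction to countable index sets: a tensor over the `ℓ₁(J i)` is carried by countable subsets
of the index sets. -/
theorem exists_nat_norm_eq_and_sequencePairing_eq (α : FullTensorNorm.{u} 𝕜 n)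
    (w : ⨂[𝕜] i, EllOne 𝕜 (J i)) :
    ∃ (f : ∀ i, J i ≃. ULift.{u} ℕ) (v : ⨂[𝕜] _ : Fin n, EllOne 𝕜 (ULift.{u} ℕ)),
      ‖α.ofTensor _ v‖ = ‖α.ofTensor _ w‖ ∧
      (∀ x, sequencePairing (fun _ => ULift.{u} ℕ) v x =
        sequencePairing J w (PiTensorProduct.map (fun i => (f i).symm.cZero.toLinearMap) x)) ∧
      ∀ x, sequencePairing J w x = sequencePairing (fun _ => ULift.{u} ℕ) v
        (PiTensorProduct.map (fun i => (f i).cZero.toLinearMap) x) := by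
  obtain ⟨A, hA, hA'⟩ := exists_countable_support w
  obtain ⟨f, hf⟩ := exists_pequiv_nat A hA
  have h1 := hA' f fun i j hj => (hf i j).2 hj
  generalize hv : PiTensorProduct.map (fun i => (f i).ellOne.toLinearMap) w = v at h1
  -- The norms agree because `v` is the image of `w` under a contraction and `w` the image of `v`
  -- under another. Each pairing identity is adjointness for one of these two directions.
  refine ⟨f, v, le_antisymm ?_ ?_, fun x => ?_, fun x => ?_⟩
  · rw [← hv]
    exact norm_mapL_apply_le α (fun i => (f i).norm_ellOne_le) (α.ofTensor _ w)
  · conv_lhs => rw [← h1]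
    exact norm_mapL_apply_le α (fun i => (f i).symm.norm_ellOne_le) (α.ofTensor _ v)
  · rw [← hv]
    exact sequencePairing_map f w x
  · conv_lhs => rw [← h1]
    exact sequencePairing_map (fun i => (f i).symm) v x

theorem HasSRN.exists_dual_norm_eq (h : α.HasSRN) (v : ⨂[𝕜] _ : Fin n, EllOne 𝕜 (ULift.{u} ℕ)) :
    ∃ ψ : StrongDual 𝕜 (α.dual.Space (fun _ => CZero 𝕜 (ULift.{u} ℕ))),
      ‖ψ‖ = ‖α.ofTensor _ v‖ ∧ ∀ x, ψ (α.dual.ofTensor _ x) =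
        sequencePairing (fun _ => ULift.{u} ℕ) v x := by
  obtain ⟨Φ, hΦ⟩ := h.exists_equiv
  exact ⟨_, (Φ.norm_map _).trans (UniformSpace.Completion.norm_coe _), hΦ v⟩

/-- Over `ℕ` this is half of the isometry; pushing `x` to `ℕ` does not increase its `α'`-norm. -/
theorem HasSRN.norm_sequencePairing_le (h : α.HasSRN) (w : ⨂[𝕜] i, EllOne 𝕜 (J i))
    (x : ⨂[𝕜] i, CZero 𝕜 (J i)) :
    ‖sequencePairing J w x‖ ≤ ‖α.ofTensor _ w‖ * ‖α.dual.ofTensor _ x‖ := by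
  obtain ⟨f, v, hv, -, h2⟩ := exists_nat_norm_eq_and_sequencePairing_eq α w
  obtain ⟨ψ, hψ, hψ'⟩ := h.exists_dual_norm_eq v
  rw [h2, ← hψ', ← hv, ← hψ]
  refine (ψ.le_opNorm _).trans (mul_le_mul_of_nonneg_left ?_ (norm_nonneg ψ))
  exact norm_mapL_apply_le α.dual (fun i => (f i).norm_cZero_le) (α.dual.ofTensor _ x)

/-- The other half of the isometry: test tensors over `ℕ` pull back to the `J i` without increasing
their `α'`-norm, so the bound passes to the transported tensor. -/
theorem HasSRN.norm_ofTensor_le (h : α.HasSRN) (w : ⨂[𝕜] i, EllOne 𝕜 (J i)) {C : ℝ} (hC : 0 ≤ C)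
    (hw : ∀ x : ⨂[𝕜] i, CZero 𝕜 (J i), ‖sequencePairing J w x‖ ≤ C * ‖α.dual.ofTensor _ x‖) :
    ‖α.ofTensor _ w‖ ≤ C := by
  obtain ⟨f, v, hv, h1, -⟩ := exists_nat_norm_eq_and_sequencePairing_eq α w
  obtain ⟨ψ, hψ, hψ'⟩ := h.exists_dual_norm_eq v
  rw [← hv, ← hψ]
  refine ψ.opNorm_le_bound hC fun x => ?_
  obtain ⟨x, rfl⟩ := (α.dual.ofTensor _).surjective x
  rw [hψ', h1]
  exact (hw _).trans (mul_le_mul_of_nonneg_left (norm_mapL_apply_le α.dual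
    (fun i => (f i).symm.norm_cZero_le) (α.dual.ofTensor _ x)) hC)

/-- The canonical bounded operator from `⨂ ℓ₁(J i)`, normed by `α`, to the dual of
`⨂ c₀(J i)`, normed by `α'`. -/
def HasSRN.toDualL (h : α.HasSRN) (J : Fin n → Type u) :
    α.Space (fun i => EllOne 𝕜 (J i)) →L[𝕜]
      StrongDual 𝕜 (α.dual.Space (fun i => CZero 𝕜 (J i))) :=
  LinearMap.mkContinuous₂
    ((sequencePairing J).compl₁₂ (α.ofTensor _).symm.toLinearMap
      (α.dual.ofTensor _).symm.toLinearMap) 1 fun w x => by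
    rw [one_mul]
    exact h.norm_sequencePairing_le ((α.ofTensor _).symm w) ((α.dual.ofTensor _).symm x)

/-- The canonical isometric embedding of `⨂ ℓ₁(J i)`, normed by `α`, into the dual of
`⨂ c₀(J i)`, normed by `α'`. -/
def HasSRN.toDual (h : α.HasSRN) (J : Fin n → Type u) :
    α.Space (fun i => EllOne 𝕜 (J i)) →ₗᵢ[𝕜]
      StrongDual 𝕜 (α.dual.Space (fun i => CZero 𝕜 (J i))) :=
  { (h.toDualL J).toLinearMap with
    norm_map' := fun w => by
      obtain ⟨w, rfl⟩ := (α.ofTensor _).surjective w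
      refine le_antisymm (ContinuousLinearMap.opNorm_le_bound _ (norm_nonneg _) fun x =>
        h.norm_sequencePairing_le w x) (h.norm_ofTensor_le w (norm_nonneg _) fun x => ?_)
      exact (h.toDualL J (α.ofTensor _ w)).le_opNorm (α.dual.ofTensor _ x) }

theorem HasSRN.toDual_ofTensor (h : α.HasSRN) (w : ⨂[𝕜] i, EllOne 𝕜 (J i))
    (x : ⨂[𝕜] i, CZero 𝕜 (J i)) :
    h.toDual J (α.ofTensor _ w) (α.dual.ofTensor _ x) = sequencePairing J w x := rfl

/-- The canonical isometric embedding of the completed tensor product of the `ℓ₁(J i)`. -/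
def HasSRN.completedToDual (h : α.HasSRN) (J : Fin n → Type u) :
    α.Completed (fun i => EllOne 𝕜 (J i)) →ₗᵢ[𝕜]
      StrongDual 𝕜 (α.dual.Space (fun i => CZero 𝕜 (J i))) :=
  { (h.toDual J).toContinuousLinearMap.extendCompletion.toLinearMap with
    norm_map' := fun z => by
      change ‖(h.toDual J).toContinuousLinearMap.extendCompletion z‖ = ‖z‖
      induction z using UniformSpace.Completion.induction_on with
      | hp => exact isClosed_eq (by fun_prop) (by fun_prop)
      | ih w => simp }

@[simp]
theorem HasSRN.completedToDual_coe (h : α.HasSRN) (w : α.Space (fun i => EllOne 𝕜 (J i))) :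
    h.completedToDual J (w : UniformSpace.Completion _) = h.toDual J w :=
  (h.toDual J).toContinuousLinearMap.extendCompletion_coe w

/-! ### Surjectivity of the embedding -/

/-- The completed operator `⨂ ℓ₁(J i) → ⨂ ℓ₁(K i)` induced by partial equivalences. -/
theorem HasSRN.exists_completedToDual_eq {K : Fin n → Type u} (h : α.HasSRN)
    (f : ∀ i, K i ≃. J i) (z : α.Completed (fun i => EllOne 𝕜 (K i))) :
    ∃ y, h.completedToDual J y =
      (h.completedToDual K z).comp (α.dual.mapL fun i => (f i).symm.cZero) := by
  let R := ((UniformSpace.Completion.toComplL (𝕜 := 𝕜)).comp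
    (α.mapL fun i => (f i).ellOne (𝕜 := 𝕜))).extendCompletion
  refine ⟨R z, ?_⟩
  induction z using UniformSpace.Completion.induction_on with
  | hp =>
    refine isClosed_eq (by fun_prop) ?_
    exact ((ContinuousLinearMap.precomp 𝕜 _).continuous).comp
      (h.completedToDual K).continuous
  | ih w =>
    have h1 : R (w : UniformSpace.Completion _) =
      (α.mapL (fun i => (f i).ellOne) w : UniformSpace.Completion _) :=
      ContinuousLinearMap.extendCompletion_coe _ w
    rw [h1, completedToDual_coe, completedToDual_coe]
    ext x
    exact sequencePairing_map f w x

/-- The isomorphism provided by sRN and the embedding constructed here agree on the dense image of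
the algebraic tensors, hence everywhere. -/
theorem HasSRN.completedToDual_nat_surjective (h : α.HasSRN) :
    Function.Surjective (h.completedToDual fun _ => ULift.{u} ℕ) := by
  obtain ⟨Φ, hΦ⟩ := h.exists_equiv
  intro ψ
  refine ⟨Φ.symm ψ, ?_⟩
  suffices ∀ z, h.completedToDual (fun _ => ULift.{u} ℕ) z = Φ z by
    rw [this, Φ.apply_symm_apply]
  intro z
  induction z using UniformSpace.Completion.induction_on with
  | hp => exact isClosed_eq (by fun_prop) Φ.continuous
  | ih w =>
    rw [completedToDual_coe]
    ext x
    exact (hΦ w x).symm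

/-- The coefficients of a functional in the range of the canonical map tend to zero. -/
theorem HasSRN.tendsto_completedToDual_single (h : α.HasSRN)
    (z : α.Completed (fun i => EllOne 𝕜 (J i))) :
    Tendsto (fun j : ∀ i, J i =>
      h.completedToDual J z (α.dual.ofTensor _ (⨂ₜ[𝕜] i, CZero.single (j i)))) cofinite (𝓝 0) := by
  rw [Metric.tendsto_nhds]
  intro δ hδ
  -- Tensors of unit vectors have `α'`-norm at most `1`, so replacing `z` by an algebraic tensor `w`
  -- changes all coefficients by less than `δ / 2` uniformly.
  obtain ⟨w, hw⟩ := UniformSpace.Completion.denseRange_coe.exists_dist_lt z (half_pos hδ)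
  obtain ⟨w, rfl⟩ := (α.ofTensor _).surjective w
  filter_upwards [Metric.tendsto_nhds.1 (tendsto_sequencePairing_single w) _ (half_pos hδ)] with j hj
  rw [dist_zero_right] at hj ⊢
  set e := α.dual.ofTensor _ (⨂ₜ[𝕜] i, (CZero.single (j i) : CZero 𝕜 (J i))) with he
  have h1 : ‖e‖ ≤ 1 := (α.dual.norm_ofTensor_tprod_le _).trans
    (Finset.prod_le_one (fun _ _ => norm_nonneg _) fun i _ => CZero.norm_single_le _)
  have h2 : ‖h.completedToDual J (z - α.ofTensor _ w) e‖ < δ / 2 := by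
    refine lt_of_le_of_lt (ContinuousLinearMap.le_opNorm _ _) ?_
    rw [LinearIsometry.norm_map, ← dist_eq_norm]
    exact (mul_le_of_le_one_right dist_nonneg h1).trans_lt hw
  have h3 : h.completedToDual J z e = h.completedToDual J (z - α.ofTensor _ w) e +
      sequencePairing J w (⨂ₜ[𝕜] i, CZero.single (j i)) := by
    rw [map_sub, completedToDual_coe, sub_apply, ← h.toDual_ofTensor, ← he, sub_add_cancel]
  rw [h3]
  exact (norm_add_le _ _).trans_lt ((add_lt_add h2 hj).trans_eq (add_halves δ))

/-- The heart of surjectivity: infinitely many large coefficients would already occur on countable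
index sets, where sRN forces the coefficients to tend to zero. -/
theorem HasSRN.finite_large_coefficients (h : α.HasSRN)
    (ψ : StrongDual 𝕜 (α.dual.Space (fun i => CZero 𝕜 (J i)))) {δ : ℝ} (hδ : 0 < δ) :
    {j : ∀ i, J i | δ ≤ ‖ψ (α.dual.ofTensor _ (⨂ₜ[𝕜] i, CZero.single (j i)))‖}.Finite := by
  by_contra hinf
  let s := Set.Infinite.natEmbedding _ hinf
  obtain ⟨f, hf⟩ := exists_pequiv_nat (fun i => Set.range fun m => (s m).1 i)
    fun i => Set.countable_range _
  have hs : ∀ m i, (f i ((s m).1 i)).isSome := fun m i => (hf i _).2 ⟨m, rfl⟩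
  let g : ℕ → ∀ _ : Fin n, ULift.{u} ℕ := fun m i => (f i ((s m).1 i)).get (hs m i)
  have hg : ∀ m i, g m i ∈ f i ((s m).1 i) := fun m i => Option.get_mem (hs m i)
  -- The transported multi-indices remain distinct, since each `f i` is injective on its domain.
  have hginj : Function.Injective g := fun m m' hm => s.injective <| Subtype.ext <| funext fun i =>
    (f i).inj (hg m i) (hm ▸ hg m' i)
  -- The coefficient of the transported functional at `g m` is that of `ψ` at `s m`, hence of
  -- modulus at least `δ`.
  obtain ⟨z, hz⟩ := h.completedToDual_nat_surjective
    (ψ.comp (α.dual.mapL fun i => (f i).symm.cZero))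
  have h1 := Metric.tendsto_nhds.1 (h.tendsto_completedToDual_single z) δ hδ
  rw [eventually_cofinite] at h1
  refine Set.infinite_range_of_injective hginj (h1.subset ?_)
  rintro _ ⟨m, rfl⟩
  have h2 : ∀ i, (f i).symm.cZero (CZero.single (g m i) : CZero 𝕜 _) =
      CZero.single ((s m).1 i) := fun i =>
    (f i).symm.cZero_single_of_mem ((f i).mem_iff_mem.2 (hg m i))
  rw [Set.mem_ofPred_eq, dist_zero_right, not_lt, hz, ContinuousLinearMap.comp_apply,
    mapL_ofTensor_tprod]
  simp only [h2]
  exact (s m).2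

theorem HasSRN.countable_coefficients (h : α.HasSRN)
    (ψ : StrongDual 𝕜 (α.dual.Space (fun i => CZero 𝕜 (J i)))) :
    {j : ∀ i, J i | ψ (α.dual.ofTensor _ (⨂ₜ[𝕜] i, CZero.single (j i))) ≠ 0}.Countable := by
  refine (Set.countable_iUnion fun m : ℕ =>
    (h.finite_large_coefficients ψ (Nat.one_div_pos_of_nat (α := ℝ) (n := m))).countable).mono ?_
  intro j hj
  obtain ⟨m, hm⟩ := exists_nat_one_div_lt (norm_pos_iff.2 hj)
  exact Set.mem_iUnion.2 ⟨m, hm.le⟩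

theorem HasSRN.completedToDual_surjective (h : α.HasSRN) (J : Fin n → Type u) :
    Function.Surjective (h.completedToDual J) := by
  intro ψ
  -- The domain of `f i` is the projection to `J i` of the countable set of multi-indices with
  -- nonzero coefficient.
  obtain ⟨f, hf⟩ := exists_pequiv_nat (fun i => (fun j : ∀ i, J i => j i) '' _)
    fun i => (h.countable_coefficients ψ).image _
  obtain ⟨z, hz⟩ := h.completedToDual_nat_surjective
    (ψ.comp (α.dual.mapL fun i => (f i).symm.cZero))
  obtain ⟨y, hy⟩ := h.exists_completedToDual_eq (fun i => (f i).symm) z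
  refine ⟨y, ?_⟩
  rw [hy, hz]
  -- It remains to see that `ψ` is unchanged by the round trip through `ℕ`, which is checked on
  -- tensors of unit vectors.
  refine α.dual.dual_ext_of_dense (fun _ => CZero.single)
    (fun _ => CZero.dense_span_single) fun j => ?_
  rw [ContinuousLinearMap.comp_apply, ContinuousLinearMap.comp_apply, mapL_ofTensor_tprod,
    mapL_ofTensor_tprod]
  simp only [PEquiv.symm_symm]
  -- Inside the domains the round trip fixes the unit vectors. Otherwise one factor is killed, and
  -- the coefficient of `ψ` vanishes because a coordinate of `j` lies outside the corresponding
  -- projection.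
  by_cases hj : ∀ i, (f i (j i)).isSome
  · congr 3
    funext i
    obtain ⟨k, hk⟩ := Option.isSome_iff_exists.1 (hj i)
    rw [(f i).cZero_single_of_mem hk, (f i).symm.cZero_single_of_mem ((f i).mem_iff_mem.2 hk)]
  · push Not at hj
    obtain ⟨i, hi⟩ := hj
    have h1 : (⨂ₜ[𝕜] i, (f i).symm.cZero ((f i).cZero (CZero.single (j i) : CZero 𝕜 _))) = 0 := by
      refine (PiTensorProduct.tprod 𝕜).map_coord_zero i ?_
      rw [(f i).cZero_single_of_eq_none (by simpa using hi), map_zero]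
    rw [h1, map_zero, map_zero]
    by_contra h2
    exact hi ((hf i _).2 ⟨j, Ne.symm h2, rfl⟩)

theorem HasSRN.canonicalDuality (h : α.HasSRN) (J : Fin n → Type u) : α.CanonicalDuality J := by
  refine ⟨(LinearIsometryEquiv.ofSurjective _ (h.completedToDual_surjective J)).trans
    (dualCompletionEquiv 𝕜 _).symm, fun a x => ?_⟩
  rw [elementary_eq, elementary_eq, LinearIsometryEquiv.trans_apply,
    dualCompletionEquiv_symm_apply_coe, LinearIsometryEquiv.coe_ofSurjective, completedToDual_coe,
    toDual_ofTensor, sequencePairing_tprod]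
  rfl

end FullTensorNorm

end

theorem mainTheorem12 {𝕜 : Type} [RCLike 𝕜] (n : ℕ) (α : FullTensorNorm.{u} 𝕜 n)
    (hα : α.IsFinitelyGenerated) (hsRN : α.HasSRN) (J : Fin n → Type u) :
    α.CanonicalDuality J :=
  hsRN.canonicalDuality J
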